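/- For $n\ge 2$ let $\mathsf M_n$ be the algebra of complex $n\times n$ matrices, let $\mathsf M_n^{\mathrm{sa}}$ be the real vector space of Hermitian matrices in $\mathsf M_n$, and let $\mathsf M_n^+\subset \mathsf M_n^{\mathrm{sa}}$ be the cone of positive semidefinite matrices, whose interior $\mathrm{int}(\mathsf M_n^+)$ is taken in $\mathsf M_n^{\mathrm{sa}}$. A real-linear map $\Psi:\mathsf M_n^{\mathrm{sa}}\to\mathsf M_n^{\mathrm{sa}}$ is called $\mathsf M_n^+$-positive if $\Psi(\mathsf M_n^+)\subset \mathsf M_n^+$, strictly $\mathsf M_n^+$-positive if $\Psi(\mathsf M_n^+\setminus\{0\})\subset \mathrm{int}(\mathsf M_n^+)$, and $\mathsf M_n^+$-primitive if it is $\mathsf M_n^+$-positive and $\Psi^k$ is strictly $\mathsf M_n^+$-positive for some integer $k\ge 1$; in that case the smallest such $k$ is denoted by $\gamma(\mathsf M_n^+,\Psi)$. Let $$\gamma(\mathsf M_n^+)=\sup\{\gamma(\mathsf M_n^+,\Psi)\ :\ \Psi:\mathsf M_n^{\mathrm{sa}}\to\mathsf M_n^{\mathrm{sa}}\ \text{real-linear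 and } \mathsf M_n^+\text{-primitive}\},$$ $$\gamma^{\mathrm{cp}}(\mathsf M_n^+)=\sup\{\gamma(\mathsf M_n^+,\Phi)\ :\ \Phi:\mathsf M_n\to\mathsf M_n\ \text{completely positive and } \mathsf M_n^+\text{-primitive}\},$$ where a completely positive map $\Phi$, which is complex-linear and preserves Hermitian matrices, is identified with the real-linear map that it induces on $\mathsf M_n^{\mathrm{sa}}$. **Theorem.** We have $\gamma(\mathsf M_2^+)=4$ and $\gamma^{\mathrm{cp}}(\mathsf M_2^+)=3$. -/

import Mathlib

section Cones

variable {V : Type*} [AddCommGroup V] [Module ℝ V]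

/-- `Ψ` is `C`-positive: `Ψ(C) ⊆ C`. -/
def IsConePositive (C : PointedCone ℝ V) (Ψ : V →ₗ[ℝ] V) : Prop :=
  ∀ x ∈ C, Ψ x ∈ C

variable [TopologicalSpace V]

/-- `Ψ` is strictly `C`-positive: `Ψ(C \ {0}) ⊆ int(C)`. -/
def IsConeStrictlyPositive (C : PointedCone ℝ V) (Ψ : V →ₗ[ℝ] V) : Prop :=
  ∀ x ∈ C, x ≠ 0 → Ψ x ∈ interior (C : Set V)

/-- `Ψ` is `C`-primitive: it is `C`-positive and `Ψ ^ k` is strictly `C`-positive for some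
integer `k ≥ 1`. -/
def IsConePrimitive (C : PointedCone ℝ V) (Ψ : V →ₗ[ℝ] V) : Prop :=
  IsConePositive C Ψ ∧ ∃ k : ℕ, 1 ≤ k ∧ IsConeStrictlyPositive C (Ψ ^ k)

/-- The `C`-primitivity index `γ(C, Ψ)`: the smallest integer `k ≥ 1` such that `Ψ ^ k` is strictly
`C`-positive. It is only used for `C`-primitive maps, for which such a `k` exists. -/
noncomputable def primitivityIndex (C : PointedCone ℝ V) (Ψ : V →ₗ[ℝ] V) : ℕ :=
  sInf {k : ℕ | 1 ≤ k ∧ IsConeStrictlyPositive C (Ψ ^ k)}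

/-- The maximal exponent `γ(C)`: the supremum, in `ℕ ∪ {∞}`, of `γ(C, Ψ)` over all `C`-primitive
linear maps `Ψ : V → V`. -/
noncomputable def maximalExponent (C : PointedCone ℝ V) : ℕ∞ :=
  ⨆ (Ψ : V →ₗ[ℝ] V) (_ : IsConePrimitive C Ψ), (primitivityIndex C Ψ : ℕ∞)

end Cones

section Matrices

open scoped ComplexOrder

/-- The real vector space of complex Hermitian `n × n` matrices, in which the cone of positive
semidefinite matrices is a proper cone. It carries the subspace topology, which is the usual one. -/
abbrev HermitianMatrix (n : ℕ) : Type :=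
  selfAdjoint (Matrix (Fin n) (Fin n) ℂ)

/-- The cone `M_n^+` of positive semidefinite complex `n × n` matrices. -/
def psdCone (n : ℕ) : PointedCone ℝ (HermitianMatrix n) where
  carrier := {X | (X : Matrix (Fin n) (Fin n) ℂ).PosSemidef}
  add_mem' := fun hX hY => Matrix.PosSemidef.add hX hY
  zero_mem' := Matrix.PosSemidef.zero
  smul_mem' := fun c _ hX => Matrix.PosSemidef.smul (α := ℝ) hX c.2

open scoped Matrix.Norms.L2Operator MatrixOrder CStarAlgebra

/-- The real-linear map induced on Hermitian matrices by a completely positive map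
`Φ : M_n → M_n`. Here `M_n` is the C⋆-algebra of complex `n × n` matrices, with the operator norm and
with the order given by positive semidefiniteness. -/
noncomputable def hermitianPart {n : ℕ}
    (Φ : Matrix (Fin n) (Fin n) ℂ →CP Matrix (Fin n) (Fin n) ℂ) :
    HermitianMatrix n →ₗ[ℝ] HermitianMatrix n where
  toFun X := ⟨Φ X, IsSelfAdjoint.map' X.2 Φ⟩
  map_add' X Y := Subtype.ext (map_add Φ (X : Matrix (Fin n) (Fin n) ℂ) Y)
  map_smul' c X := Subtype.ext
    (map_smul Φ (c : ℂ) (X : Matrix (Fin n) (Fin n) ℂ))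

/-- `γ^cp(M_n^+)`: the supremum, in `ℕ ∪ {∞}`, of `γ(M_n^+, Φ)` over all maps `Φ : M_n → M_n` that
are completely positive and `M_n^+`-primitive. -/
noncomputable def cpMaximalExponent (n : ℕ) : ℕ∞ :=
  ⨆ (Φ : Matrix (Fin n) (Fin n) ℂ →CP Matrix (Fin n) (Fin n) ℂ)
    (_ : IsConePrimitive (psdCone n) (hermitianPart Φ)),
    (primitivityIndex (psdCone n) (hermitianPart Φ) : ℕ∞)

end Matrices

/-!
The cone of positive semidefinite `2 × 2` matrices is the forward Lorentz cone in a 4-dimensional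
space, for the bilinear form `detForm` with `detForm X X = 2 * det X`
(`mem_psdCone_two_iff`, `mem_interior_psdCone_two_iff`). A primitive map `Ψ` preserves the interior
of the cone, so if `Ψ ^ p` is not strictly positive then some orbit `X, Ψ X, …, Ψ ^ p X` consists of
nonzero null vectors (`IsConePrimitive.exists_null_orbit`). Both upper bounds show that a null orbit
that is too long never leaves the boundary, which contradicts primitivity.

*All positive maps.* If `X` and `Ψ X` are null, then `detForm (Ψ ·) (Ψ X)` is nonnegative on the cone
and vanishes at `X`. As the cone has a unique supporting hyperplane along `X`, this functional equals
`c * detForm · X` for a constant `c` (`IsConePositive.exists_detForm_map_eq`). By symmetry of the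
form, the constants at consecutive orbit points agree, unless these are proportional, which
primitivity forbids. So if `Ψ ^ 4` is not strictly positive, the four vectors `Ψ ^ i X`, `i < 4`, lie
in the subspace `conformalSubspace Ψ c` for a single `c`. By Cayley-Hamilton in dimension 4 it
contains the whole orbit, and on that orbit `det (Ψ Y) = c * det Y`, so the orbit stays null.

*Completely positive maps.* With Kraus operators `A k` (`exists_kraus`), the Lagrange identity
makes `det (Φ (v * vᴴ))` a sum of squared moduli of the binary quadratic forms
`det [A k v, A l v]`. A null orbit of length 3 gives three pairwise non-proportional `v` where
all of these vanish; a binary quadratic form with three projective zeros is zero, so `Φ` maps every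
rank-one matrix to a singular one (`detForm_hermitianPart_eq_zero`).

The bounds are attained by `exponentFourMap` and `exponentThreeMap`, on the orbit of the matrix unit
`E₀₀`.
-/

open scoped ComplexOrder

/-! ### Positive semidefinite `2 × 2` matrices as a Lorentz cone -/

/-- The real coordinates `(a, b, c, d)` of the Hermitian matrix `!![a, c + d i; c - d i, b]`. -/
noncomputable def hermitianCoords : HermitianMatrix 2 ≃ₗ[ℝ] (Fin 4 → ℝ) where
  toFun X := ![(X.1 0 0).re, (X.1 1 1).re, (X.1 0 1).re, (X.1 0 1).im]
  map_add' X Y := by ext i; fin_cases i <;> simp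
  map_smul' c X := by ext i; fin_cases i <;> simp
  invFun v := ⟨!![(v 0 : ℂ), ⟨v 2, v 3⟩; ⟨v 2, -v 3⟩, (v 1 : ℂ)], by
    rw [selfAdjoint.mem_iff, Matrix.star_eq_conjTranspose]
    ext i j; fin_cases i <;> fin_cases j <;> apply Complex.ext <;> simp⟩
  left_inv X := by
    have h : ∀ i j, star (X.1 j i) = X.1 i j := fun i j => congrFun (congrFun X.2 i) j
    have h00 := congrArg Complex.im (h 0 0)
    have h11 := congrArg Complex.im (h 1 1)
    have h10 := h 1 0
    simp at h00 h11
    ext i j; fin_cases i <;> fin_cases j <;> apply Complex.ext <;> simp [← h10] <;> linarith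
  right_inv v := by ext i; fin_cases i <;> simp

lemma hermitian_eq_of_coords (X : HermitianMatrix 2) :
    X.1 = !![(hermitianCoords X 0 : ℂ), ⟨hermitianCoords X 2, hermitianCoords X 3⟩;
      ⟨hermitianCoords X 2, -hermitianCoords X 3⟩, (hermitianCoords X 1 : ℂ)] :=
  congrArg Subtype.val (hermitianCoords.left_inv X).symm

lemma finrank_hermitianMatrix_two : Module.finrank ℝ (HermitianMatrix 2) = 4 := by
  simpa using hermitianCoords.finrank_eq

/-- The Lorentz form on Hermitian `2 × 2` matrices: the symmetric bilinear form with
`detForm X X = 2 * det X`. -/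
noncomputable def detForm : LinearMap.BilinForm ℝ (HermitianMatrix 2) :=
  LinearMap.mk₂ ℝ (fun X Y =>
    hermitianCoords X 0 * hermitianCoords Y 1 + hermitianCoords X 1 * hermitianCoords Y 0
      - 2 * (hermitianCoords X 2 * hermitianCoords Y 2)
      - 2 * (hermitianCoords X 3 * hermitianCoords Y 3))
    (by intros; simp only [map_add, Pi.add_apply]; ring)
    (by intros; simp only [map_smul, Pi.smul_apply, smul_eq_mul]; ring)
    (by intros; simp only [map_add, Pi.add_apply]; ring)
    (by intros; simp only [map_smul, Pi.smul_apply, smul_eq_mul]; ring)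

lemma detForm_apply (X Y : HermitianMatrix 2) : detForm X Y =
    hermitianCoords X 0 * hermitianCoords Y 1 + hermitianCoords X 1 * hermitianCoords Y 0
      - 2 * (hermitianCoords X 2 * hermitianCoords Y 2)
      - 2 * (hermitianCoords X 3 * hermitianCoords Y 3) := rfl

lemma detForm_comm (X Y : HermitianMatrix 2) : detForm X Y = detForm Y X := by
  simp only [detForm_apply]; ring

/-- The trace of a Hermitian `2 × 2` matrix. -/
noncomputable def hermitianTrace : HermitianMatrix 2 →ₗ[ℝ] ℝ where
  toFun X := hermitianCoords X 0 + hermitianCoords X 1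
  map_add' X Y := by simp only [map_add, Pi.add_apply]; ring
  map_smul' c X := by simp only [map_smul, Pi.smul_apply, smul_eq_mul, RingHom.id_apply]; ring

lemma hermitianTrace_apply (X : HermitianMatrix 2) :
    hermitianTrace X = hermitianCoords X 0 + hermitianCoords X 1 := rfl

lemma hermitian_coords_one (i : Fin 4) :
    hermitianCoords (1 : HermitianMatrix 2) i = ![1, 1, 0, 0] i := by
  fin_cases i <;> simp [hermitianCoords]

lemma detForm_one_left (X : HermitianMatrix 2) : detForm 1 X = hermitianTrace X := by
  simp only [detForm_apply, hermitian_coords_one, hermitianTrace_apply]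
  simp; ring

lemma eq_zero_of_trace_eq_zero {X : HermitianMatrix 2} (ht : hermitianTrace X = 0)
    (hq : 0 ≤ detForm X X) : X = 0 := by
  rw [hermitianTrace_apply] at ht
  rw [detForm_apply] at hq
  have hb : hermitianCoords X 1 = -hermitianCoords X 0 := by linarith
  rw [hb] at hq
  have h0 : hermitianCoords X 0 = 0 := pow_eq_zero_iff two_ne_zero |>.1 (by nlinarith)
  have h2 : hermitianCoords X 2 = 0 := pow_eq_zero_iff two_ne_zero |>.1 (by nlinarith)
  have h3 : hermitianCoords X 3 = 0 := pow_eq_zero_iff two_ne_zero |>.1 (by nlinarith)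
  apply hermitianCoords.injective
  ext i
  fin_cases i <;> simp [h0, h2, h3, hb]

/-- The positive semidefinite cone of `2 × 2` matrices is the forward Lorentz cone. -/
lemma mem_psdCone_two_iff {X : HermitianMatrix 2} :
    X ∈ psdCone 2 ↔ 0 ≤ hermitianTrace X ∧ 0 ≤ detForm X X := by
  change X.1.PosSemidef ↔ _
  constructor
  · intro h
    have h0 := h.diag_nonneg (i := 0)
    have h1 := h.diag_nonneg (i := 1)
    have hd := h.det_nonneg
    rw [hermitian_eq_of_coords X] at h0 h1 hd
    rw [Matrix.det_fin_two, Complex.le_def] at hd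
    simp at h0 h1 hd
    rw [hermitianTrace_apply, detForm_apply]
    constructor <;> linarith
  · rintro ⟨ht, hq⟩
    rcases ht.eq_or_lt with ht | ht
    · rw [eq_zero_of_trace_eq_zero ht.symm hq]
      exact Matrix.PosSemidef.zero
    -- Cayley-Hamilton: `tr X • X = X ^ 2 + det X • 1`
    have key : X.1 = (hermitianTrace X)⁻¹ • (X.1.conjTranspose * X.1
        + (detForm X X / 2) • (1 : Matrix (Fin 2) (Fin 2) ℂ)) := by
      rw [eq_inv_smul_iff₀ ht.ne', hermitianTrace_apply, detForm_apply]
      conv_lhs => rw [hermitian_eq_of_coords X]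
      conv_rhs => rw [hermitian_eq_of_coords X]
      ext i j; fin_cases i <;> fin_cases j <;> apply Complex.ext <;>
        simp [Matrix.mul_apply, Fin.sum_univ_two] <;> ring
    rw [key]
    exact ((Matrix.posSemidef_conjTranspose_mul_self _).add
      (Matrix.PosSemidef.one.smul (by positivity))).smul (by positivity)

lemma hermitianTrace_pos {X : HermitianMatrix 2} (hX : X ∈ psdCone 2) (h0 : X ≠ 0) :
    0 < hermitianTrace X := by
  rw [mem_psdCone_two_iff] at hX
  exact hX.1.lt_of_ne fun h => h0 (eq_zero_of_trace_eq_zero h.symm hX.2)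

lemma continuous_hermitianCoords (i : Fin 4) :
    Continuous fun X : HermitianMatrix 2 => hermitianCoords X i := by
  have h : ∀ k l, Continuous fun X : HermitianMatrix 2 => X.1 k l := fun k l =>
    continuous_subtype_val.matrix_elem k l
  fin_cases i
  · exact Complex.continuous_re.comp (h 0 0)
  · exact Complex.continuous_re.comp (h 1 1)
  · exact Complex.continuous_re.comp (h 0 1)
  · exact Complex.continuous_im.comp (h 0 1)

lemma exists_pos_sub_smul_mem {n : ℕ} {X : HermitianMatrix n}
    (hX : X ∈ interior (psdCone n : Set (HermitianMatrix n))) (W : HermitianMatrix n) :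
    ∃ ε : ℝ, 0 < ε ∧ X - ε • W ∈ psdCone n := by
  have hc : Continuous fun t : ℝ => X - t • W := continuous_induced_rng.2 <| by
    change Continuous fun t : ℝ => X.1 - t • W.1
    fun_prop
  have hev : ∀ᶠ t in nhds (0 : ℝ), X - t • W ∈ psdCone n := by
    refine hc.continuousAt.eventually (p := (· ∈ psdCone n)) ?_
    simp only [zero_smul, sub_zero]
    exact mem_interior_iff_mem_nhds.1 hX
  obtain ⟨ε, hε, h⟩ := Metric.eventually_nhds_iff.1 hev
  exact ⟨ε / 2, by positivity, h (by rw [Real.dist_eq, sub_zero, abs_of_pos] <;> linarith)⟩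

lemma mem_interior_psdCone_two_iff {X : HermitianMatrix 2} :
    X ∈ interior (psdCone 2 : Set (HermitianMatrix 2)) ↔
      0 < hermitianTrace X ∧ 0 < detForm X X := by
  constructor
  · intro h
    obtain ⟨ε, hε, this⟩ := exists_pos_sub_smul_mem h 1
    rw [mem_psdCone_two_iff] at this
    simp only [map_sub, map_smul, LinearMap.sub_apply, LinearMap.smul_apply, detForm_one_left,
      detForm_comm X 1, smul_eq_mul] at this
    have h1 : hermitianTrace 1 = 2 := by
      rw [hermitianTrace_apply, hermitian_coords_one, hermitian_coords_one]; norm_num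
    rw [h1] at this
    constructor <;> nlinarith
  · intro h
    refine mem_interior.2 ⟨{Y | 0 < hermitianTrace Y ∧ 0 < detForm Y Y}, fun Y hY =>
      mem_psdCone_two_iff.2 ⟨hY.1.le, hY.2.le⟩, ?_, h⟩
    simp only [hermitianTrace_apply, detForm_apply]
    have h0 := continuous_hermitianCoords 0
    have h1 := continuous_hermitianCoords 1
    have h2 := continuous_hermitianCoords 2
    have h3 := continuous_hermitianCoords 3
    exact (isOpen_lt continuous_const (h0.add h1)).inter (isOpen_lt continuous_const
      ((((h0.mul h1).add (h1.mul h0)).sub (continuous_const.mul (h2.mul h2))).sub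
        (continuous_const.mul (h3.mul h3))))

/-- A positive semidefinite matrix is singular exactly when it is not an interior point. -/
lemma notMem_interior_iff_detForm_eq_zero {X : HermitianMatrix 2} (hX : X ∈ psdCone 2) :
    X ∉ interior (psdCone 2 : Set (HermitianMatrix 2)) ↔ detForm X X = 0 := by
  rw [mem_interior_psdCone_two_iff]
  constructor
  · intro h
    by_contra hq
    have hq' := (mem_psdCone_two_iff.1 hX).2.lt_of_ne' hq
    refine h ⟨hermitianTrace_pos hX ?_, hq'⟩
    rintro rfl
    simp at hq
  · rintro h ⟨-, h'⟩
    exact h'.ne' h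

/-- A null vector orthogonal to a nonzero null vector of the Lorentz cone is a multiple of it. -/
lemma eq_smul_of_detForm_eq_zero {X Y : HermitianMatrix 2} (hX : X ∈ psdCone 2) (hX0 : X ≠ 0)
    (hXX : detForm X X = 0) (hYY : detForm Y Y = 0) (hXY : detForm X Y = 0) :
    ∃ c : ℝ, Y = c • X := by
  have ht := hermitianTrace_pos hX hX0
  refine ⟨hermitianTrace Y / hermitianTrace X, sub_eq_zero.1 (eq_zero_of_trace_eq_zero ?_ ?_)⟩
  · simp [ht.ne']
  · simp [hXX, hYY, hXY, detForm_comm Y X]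

/-- A functional that is nonnegative on the Lorentz cone and vanishes at a null vector `X` is a
multiple of `detForm · X`, since the cone has only one supporting hyperplane along `X`. -/
lemma exists_eq_mul_detForm {g : HermitianMatrix 2 →ₗ[ℝ] ℝ} (hg : ∀ Z ∈ psdCone 2, 0 ≤ g Z)
    {X : HermitianMatrix 2} (hX : X ∈ psdCone 2) (hX0 : X ≠ 0) (hXX : detForm X X = 0)
    (hgX : g X = 0) : ∃ c : ℝ, ∀ Z, g Z = c * detForm Z X := by
  have ht := hermitianTrace_pos hX hX0
  -- if `Z` points to the inner side of the tangent hyperplane, then `Z + N • X` is in the cone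
  have h1 : ∀ Z, 0 < detForm Z X → 0 ≤ g Z := by
    intro Z hZ
    obtain ⟨N, hN⟩ := exists_nat_gt
      (max (-hermitianTrace Z / hermitianTrace X) (-detForm Z Z / (2 * detForm Z X)))
    rw [max_lt_iff, div_lt_iff₀ ht, div_lt_iff₀ (by positivity)] at hN
    have := hg (Z + (N : ℝ) • X) (mem_psdCone_two_iff.2 ⟨?_, ?_⟩)
    · simpa [hgX] using this
    · simp only [map_add, map_smul, smul_eq_mul]
      linarith
    · simp only [map_add, map_smul, smul_eq_mul, LinearMap.add_apply, LinearMap.smul_apply, hXX,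
        detForm_comm X Z]
      linarith
  have h2 : ∀ Z, detForm Z X = 0 → 0 ≤ g Z := by
    intro Z hZ
    by_contra! hneg
    have hg1 : 0 ≤ g 1 := h1 1 (by rwa [detForm_one_left])
    have := h1 (Z + (-g Z / (2 * (g 1 + 1))) • 1) (by
      simp only [map_add, map_smul, LinearMap.add_apply, LinearMap.smul_apply, hZ,
        detForm_one_left, smul_eq_mul]
      have : 0 < -g Z := by linarith
      positivity)
    simp only [map_add, map_smul, smul_eq_mul] at this
    have h3 : -g Z / (2 * (g 1 + 1)) * g 1 = -g Z / 2 * (g 1 / (g 1 + 1)) := by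
      field_simp
    have h4 : g 1 / (g 1 + 1) ≤ 1 := by rw [div_le_one (by linarith)]; linarith
    nlinarith
  refine ⟨g 1 / hermitianTrace X, fun Z => ?_⟩
  have h3 : detForm (Z - (detForm Z X / hermitianTrace X) • 1) X = 0 := by
    simp [detForm_one_left, ht.ne']
  have h4 := h2 _ h3
  have h5 := h2 (-(Z - (detForm Z X / hermitianTrace X) • 1)) (by
    rw [map_neg, LinearMap.neg_apply, h3, neg_zero])
  simp only [map_sub, map_neg, map_smul, smul_eq_mul] at h4 h5
  rw [div_mul_eq_mul_div, mul_comm (g 1), ← div_mul_eq_mul_div]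
  linarith

/-- The Lorentz cone is contained in its dual cone. -/
lemma detForm_nonneg {X Y : HermitianMatrix 2} (hX : X ∈ psdCone 2) (hY : Y ∈ psdCone 2) :
    0 ≤ detForm X Y := by
  by_cases hX0 : X = 0
  · simp [hX0]
  by_cases hY0 : Y = 0
  · simp [hY0]
  have hx := hermitianTrace_pos hX hX0
  have hy := hermitianTrace_pos hY hY0
  rw [mem_psdCone_two_iff] at hX hY
  -- the difference of the normalizations of `X` and `Y` is traceless, hence not timelike
  have key : detForm (hermitianTrace Y • X - hermitianTrace X • Y)
      (hermitianTrace Y • X - hermitianTrace X • Y) ≤ 0 := by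
    by_contra! hpos
    have := eq_zero_of_trace_eq_zero
      (X := hermitianTrace Y • X - hermitianTrace X • Y) (by simp; ring) hpos.le
    simp [this] at hpos
  simp only [map_sub, map_smul, LinearMap.sub_apply, LinearMap.smul_apply, smul_eq_mul,
    detForm_comm Y X] at key
  have h1 : 0 ≤ hermitianTrace Y * (hermitianTrace Y * detForm X X) := by
    have := hX.2; positivity
  have h2 : 0 ≤ hermitianTrace X * (hermitianTrace X * detForm Y Y) := by
    have := hY.2; positivity
  have h3 : 0 ≤ (hermitianTrace X * hermitianTrace Y) * detForm X Y := by linarith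
  exact nonneg_of_mul_nonneg_right h3 (by positivity)

/-! ### Orbits of positive and of primitive maps -/

lemma IsConePositive.pow_apply_mem {V : Type*} [AddCommGroup V] [Module ℝ V]
    {C : PointedCone ℝ V} {Ψ : V →ₗ[ℝ] V} (hΨ : IsConePositive C Ψ) {X : V} (hX : X ∈ C) (i : ℕ) :
    (Ψ ^ i) X ∈ C := by
  induction i with
  | zero => simpa using hX
  | succ i ih => rw [pow_succ', Module.End.mul_apply]; exact hΨ _ ih

lemma add_mem_interior_psdCone {n : ℕ} {X Y : HermitianMatrix n} (hX : X ∈ psdCone n)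
    (hY : Y ∈ interior (psdCone n : Set (HermitianMatrix n))) :
    X + Y ∈ interior (psdCone n : Set (HermitianMatrix n)) := by
  refine interior_mono ?_ (subset_interior_add_right (Set.add_mem_add hX hY))
  rintro _ ⟨A, hA, B, hB, rfl⟩
  exact (psdCone n).add_mem hA hB

lemma smul_mem_interior_psdCone_two {X : HermitianMatrix 2} {c : ℝ} (hc : 0 < c)
    (hX : X ∈ interior (psdCone 2 : Set (HermitianMatrix 2))) :
    c • X ∈ interior (psdCone 2 : Set (HermitianMatrix 2)) := by
  rw [mem_interior_psdCone_two_iff] at hX ⊢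
  simp only [map_smul, LinearMap.smul_apply, smul_eq_mul]
  exact ⟨mul_pos hc hX.1, mul_pos hc (mul_pos hc hX.2)⟩

lemma one_mem_psdCone_two : (1 : HermitianMatrix 2) ∈ psdCone 2 := Matrix.PosSemidef.one

lemma one_hermitian_ne_zero : (1 : HermitianMatrix 2) ≠ 0 := fun h => by
  simpa [hermitianTrace_apply, hermitian_coords_one] using congrArg hermitianTrace h

section Primitive

variable {Ψ : HermitianMatrix 2 →ₗ[ℝ] HermitianMatrix 2} (hΨ : IsConePrimitive (psdCone 2) Ψ)
include hΨ

/-- A primitive map preserves the interior of the cone: an interior point `Y` dominates a multiple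
of any `W` in the cone, and `W` can be chosen with `Ψ W` in the interior. -/
lemma IsConePrimitive.map_mem_interior {Y : HermitianMatrix 2}
    (hY : Y ∈ interior (psdCone 2 : Set (HermitianMatrix 2))) :
    Ψ Y ∈ interior (psdCone 2 : Set (HermitianMatrix 2)) := by
  obtain ⟨hpos, k, hk, hstr⟩ := hΨ
  obtain ⟨k, rfl⟩ := Nat.exists_eq_add_of_le' hk
  obtain ⟨ε, hε, hmem⟩ := exists_pos_sub_smul_mem hY ((Ψ ^ k) 1)
  have h1 := hstr 1 one_mem_psdCone_two one_hermitian_ne_zero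
  rw [pow_succ', Module.End.mul_apply] at h1
  have := add_mem_interior_psdCone (hpos _ hmem) (smul_mem_interior_psdCone_two hε h1)
  rwa [map_sub, map_smul, sub_add_cancel] at this

lemma IsConePrimitive.pow_apply_mem_interior_of_le {X : HermitianMatrix 2} {i j : ℕ} (hij : i ≤ j)
    (hX : (Ψ ^ i) X ∈ interior (psdCone 2 : Set (HermitianMatrix 2))) :
    (Ψ ^ j) X ∈ interior (psdCone 2 : Set (HermitianMatrix 2)) := by
  induction j, hij using Nat.le_induction with
  | base => exact hX
  | succ j _ ih => rw [pow_succ', Module.End.mul_apply]; exact hΨ.map_mem_interior ih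

lemma IsConePrimitive.exists_forall_ge :
    ∃ k : ℕ, ∀ m, k ≤ m → IsConeStrictlyPositive (psdCone 2) (Ψ ^ m) := by
  obtain ⟨k, -, hk⟩ := hΨ.2
  exact ⟨k, fun m hm X hX h0 => hΨ.pow_apply_mem_interior_of_le hm (hk X hX h0)⟩

lemma IsConePrimitive.pow_apply_ne_zero {X : HermitianMatrix 2} (hX : X ∈ psdCone 2) (h0 : X ≠ 0)
    (i : ℕ) : (Ψ ^ i) X ≠ 0 := by
  intro hi
  obtain ⟨k, hk⟩ := hΨ.exists_forall_ge
  have h := hk (k + i) (by omega) X hX h0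
  rw [pow_add, Module.End.mul_apply, hi, map_zero, mem_interior_psdCone_two_iff] at h
  simp at h

/-- The orbit of a singular positive semidefinite matrix under a primitive map is not periodic up
to scalars. -/
lemma IsConePrimitive.pow_apply_ne_smul {X : HermitianMatrix 2} (hX : X ∈ psdCone 2) (h0 : X ≠ 0)
    (hXX : detForm X X = 0) {p : ℕ} (hp : 1 ≤ p) (c : ℝ) : (Ψ ^ p) X ≠ c • X := by
  intro h
  obtain ⟨k, hk⟩ := hΨ.exists_forall_ge
  have hpow : ∀ m, (Ψ ^ (p * m)) X = c ^ m • X := by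
    intro m
    induction m with
    | zero => simp
    | succ m ih =>
      rw [mul_add, mul_one, pow_add, Module.End.mul_apply, h, map_smul, ih, smul_smul, pow_succ']
  have hint := hk (p * k) (Nat.le_mul_of_pos_left k hp) X hX h0
  rw [hpow, mem_interior_psdCone_two_iff] at hint
  simp [hXX] at hint

/-- If `Ψ ^ p` is not strictly positive, there is an orbit that stays in the boundary of the cone
up to time `p`. -/
lemma IsConePrimitive.exists_null_orbit {p : ℕ}
    (hp : ¬ IsConeStrictlyPositive (psdCone 2) (Ψ ^ p)) :
    ∃ X ∈ psdCone 2, X ≠ 0 ∧ ∀ i ≤ p, detForm ((Ψ ^ i) X) ((Ψ ^ i) X) = 0 := by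
  simp only [IsConeStrictlyPositive, not_forall] at hp
  obtain ⟨X, hX, h0, h⟩ := hp
  exact ⟨X, hX, h0, fun i hi => (notMem_interior_iff_detForm_eq_zero (hΨ.1.pow_apply_mem hX i)).1
    fun hint => h (hΨ.pow_apply_mem_interior_of_le hi hint)⟩

end Primitive

/-! ### The upper bound for positive maps -/

/-- If a vector and its first `finrank - 1` iterates under `f` lie in a subspace, so does the whole
orbit, by the Cayley-Hamilton theorem. -/
lemma pow_apply_mem_of_forall_lt_finrank {V : Type*} [AddCommGroup V] [Module ℝ V]
    [FiniteDimensional ℝ V] (f : V →ₗ[ℝ] V) (K : Submodule ℝ V) (x : V)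
    (h : ∀ i < Module.finrank ℝ V, (f ^ i) x ∈ K) (n : ℕ) : (f ^ n) x ∈ K := by
  have hdeg : (Polynomial.X ^ n %ₘ f.charpoly).degree < (Module.finrank ℝ V : ℕ) := by
    rw [← f.charpoly_natDegree, ← Polynomial.degree_eq_natDegree f.charpoly_monic.ne_zero]
    exact Polynomial.degree_modByMonic_lt _ f.charpoly_monic
  rw [f.pow_eq_aeval_mod_charpoly n, Polynomial.aeval_eq_sum_range, LinearMap.sum_apply]
  refine K.sum_mem fun i _ => ?_
  rw [LinearMap.smul_apply]
  by_cases hi : i < Module.finrank ℝ V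
  · exact K.smul_mem _ (h i hi)
  · rw [Polynomial.coeff_eq_zero_of_degree_lt
      (hdeg.trans_le (by exact_mod_cast not_lt.1 hi)), zero_smul]
    exact K.zero_mem

/-- If a positive map sends a null vector `X` to a null vector, then up to a scalar it preserves
the Lorentz products with `X`. -/
lemma IsConePositive.exists_detForm_map_eq {Ψ : HermitianMatrix 2 →ₗ[ℝ] HermitianMatrix 2}
    (hΨ : IsConePositive (psdCone 2) Ψ) {X : HermitianMatrix 2} (hX : X ∈ psdCone 2) (h0 : X ≠ 0)
    (hXX : detForm X X = 0) (hΨX : detForm (Ψ X) (Ψ X) = 0) :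
    ∃ c : ℝ, ∀ Z, detForm (Ψ Z) (Ψ X) = c * detForm Z X := by
  refine exists_eq_mul_detForm (g := (detForm (Ψ X)) ∘ₗ Ψ) (fun Z hZ => ?_) hX h0 hXX hΨX
    |>.imp fun c hc Z => (detForm_comm _ _).trans (hc Z)
  exact detForm_nonneg (hΨ X hX) (hΨ Z hZ)

/-- The space of vectors whose Lorentz products are multiplied by `c` under `Ψ`. -/
noncomputable def conformalSubspace (Ψ : HermitianMatrix 2 →ₗ[ℝ] HermitianMatrix 2) (c : ℝ) :
    Submodule ℝ (HermitianMatrix 2) where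
  carrier := {X | ∀ Z, detForm (Ψ Z) (Ψ X) = c * detForm Z X}
  add_mem' hX hY Z := by simp only [map_add, hX Z, hY Z]; ring
  zero_mem' Z := by simp
  smul_mem' r X hX Z := by simp only [map_smul, smul_eq_mul, hX Z]; ring

theorem IsConePrimitive.isConeStrictlyPositive_pow_four
    {Ψ : HermitianMatrix 2 →ₗ[ℝ] HermitianMatrix 2} (hΨ : IsConePrimitive (psdCone 2) Ψ) :
    IsConeStrictlyPositive (psdCone 2) (Ψ ^ 4) := by
  by_contra hnot
  obtain ⟨X, hX, h0, hnull⟩ := hΨ.exists_null_orbit hnot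
  have hmem := hΨ.1.pow_apply_mem hX
  have hne := hΨ.pow_apply_ne_zero hX h0
  have hsucc : ∀ i, Ψ ((Ψ ^ i) X) = (Ψ ^ (i + 1)) X := fun i => by
    rw [pow_succ', Module.End.mul_apply]
  have hex : ∀ i < 4, ∃ c : ℝ, ∀ Z, detForm (Ψ Z) (Ψ ((Ψ ^ i) X)) = c * detForm Z ((Ψ ^ i) X) :=
    fun i hi => hΨ.1.exists_detForm_map_eq (hmem i) (hne i) (hnull i hi.le)
      (by rw [hsucc]; exact hnull (i + 1) hi)
  choose! c hc using hex
  -- consecutive orbit points are not orthogonal, so their factors agree by symmetry of the form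
  have hstep : ∀ i < 3, c (i + 1) = c i := by
    intro i hi
    have h1 := hc (i + 1) (by omega) ((Ψ ^ i) X)
    rw [detForm_comm, hc i (by omega), detForm_comm] at h1
    refine (mul_right_cancel₀ (fun h => ?_) h1).symm
    obtain ⟨r, hr⟩ := eq_smul_of_detForm_eq_zero (hmem i) (hne i) (hnull i (by omega))
      (hnull (i + 1) (by omega)) h
    refine hΨ.pow_apply_ne_smul (hmem i) (hne i) (hnull i (by omega)) le_rfl r ?_
    rw [pow_one, hsucc, hr]
  have hc0 : ∀ i < 4, c i = c 0 := by
    intro i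
    induction i with
    | zero => intro _; rfl
    | succ i ih => intro hi; rw [hstep i (by omega), ih (by omega)]
  have : FiniteDimensional ℝ (HermitianMatrix 2) := hermitianCoords.symm.finiteDimensional
  have hK : ∀ n, (Ψ ^ n) X ∈ conformalSubspace Ψ (c 0) :=
    pow_apply_mem_of_forall_lt_finrank Ψ _ X fun i hi => by
      rw [finrank_hermitianMatrix_two] at hi
      intro Z
      rw [hc i hi, hc0 i hi]
  have hall : ∀ n, detForm ((Ψ ^ n) X) ((Ψ ^ n) X) = 0 := by
    intro n
    induction n with
    | zero => exact hnull 0 (by omega)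
    | succ n ih =>
      have := hK n ((Ψ ^ n) X)
      rwa [ih, mul_zero, hsucc] at this
  obtain ⟨k, hk⟩ := hΨ.exists_forall_ge
  exact (notMem_interior_iff_detForm_eq_zero (hmem k)).2 (hall k) (hk k le_rfl X hX h0)

/-! ### A positive map with exponent four -/

/-- The matrix unit `E₀₀`. -/
noncomputable def diagonalUnit : HermitianMatrix 2 := hermitianCoords.symm ![1, 0, 0, 0]

lemma coords_diagonalUnit : hermitianCoords diagonalUnit = ![1, 0, 0, 0] :=
  hermitianCoords.apply_symm_apply _

lemma diagonalUnit_mem_psdCone : diagonalUnit ∈ psdCone 2 := by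
  rw [mem_psdCone_two_iff, detForm_apply, hermitianTrace_apply, coords_diagonalUnit]
  simp

lemma diagonalUnit_ne_zero : diagonalUnit ≠ 0 := fun h => by
  simpa [h] using congrFun coords_diagonalUnit 0

/-- The map with `(a, b, c, d) ↦ (b, a + b, b, c)` in coordinates, that is
`X ↦ S * re X * Sᴴ` with `S = !![0, i; 1, i]`. It takes `E₀₀` through the null vectors with
coordinates `(0, 1, 0, 0)`, `(1, 1, 1, 0)`, `(1, 2, 1, 1)` to an interior point. -/
noncomputable def exponentFourMap : HermitianMatrix 2 →ₗ[ℝ] HermitianMatrix 2 :=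
  hermitianCoords.symm.toLinearMap ∘ₗ
    (Matrix.toLin' !![0, 1, 0, 0; 1, 1, 0, 0; 0, 1, 0, 0; 0, 0, 1, 0]) ∘ₗ
      hermitianCoords.toLinearMap

lemma coords_exponentFourMap (X : HermitianMatrix 2) : hermitianCoords (exponentFourMap X) =
    ![hermitianCoords X 1, hermitianCoords X 0 + hermitianCoords X 1, hermitianCoords X 1,
      hermitianCoords X 2] := by
  ext i
  fin_cases i <;> simp [exponentFourMap, dotProduct, Fin.sum_univ_four]

lemma diag_nonneg_of_mem_psdCone_two {X : HermitianMatrix 2} (hX : X ∈ psdCone 2) :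
    0 ≤ hermitianCoords X 0 ∧ 0 ≤ hermitianCoords X 1 :=
  ⟨(Complex.le_def.1 (Matrix.PosSemidef.diag_nonneg hX (i := 0))).1,
    (Complex.le_def.1 (Matrix.PosSemidef.diag_nonneg hX (i := 1))).1⟩

lemma detForm_exponentFourMap (X : HermitianMatrix 2) :
    detForm (exponentFourMap X) (exponentFourMap X) =
      detForm X X + 2 * hermitianCoords X 3 ^ 2 := by
  simp only [detForm_apply, coords_exponentFourMap]
  simp
  ring

lemma isConePrimitive_exponentFourMap : IsConePrimitive (psdCone 2) exponentFourMap := by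
  refine ⟨fun X hX => ?_, 4, by norm_num, fun X hX h0 => ?_⟩
  · have hd := diag_nonneg_of_mem_psdCone_two hX
    rw [mem_psdCone_two_iff] at hX ⊢
    rw [detForm_exponentFourMap, hermitianTrace_apply, coords_exponentFourMap]
    have := hX.2
    refine ⟨?_, by positivity⟩
    simp
    linarith
  · have hd := diag_nonneg_of_mem_psdCone_two hX
    have hq := (mem_psdCone_two_iff.1 hX).2
    have ht := hermitianTrace_pos hX h0
    simp only [pow_succ', pow_zero, Module.End.mul_apply, mul_one]
    rw [mem_interior_psdCone_two_iff]
    simp only [detForm_exponentFourMap, hermitianTrace_apply, coords_exponentFourMap] at ht ⊢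
    simp
    constructor
    · linarith
    · have := pow_pos ht 2
      positivity

theorem maximalExponent_psdCone_two : maximalExponent (psdCone 2) = 4 := by
  apply le_antisymm
  · refine iSup₂_le fun Ψ hΨ => ?_
    have : primitivityIndex (psdCone 2) Ψ ≤ 4 :=
      Nat.sInf_le ⟨by norm_num, hΨ.isConeStrictlyPositive_pow_four⟩
    exact_mod_cast this
  · refine le_trans ?_ (le_iSup₂_of_le exponentFourMap isConePrimitive_exponentFourMap le_rfl)
    have hΨ := isConePrimitive_exponentFourMap
    have : 4 ≤ primitivityIndex (psdCone 2) exponentFourMap := by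
      refine le_csInf hΨ.2 fun k hk => ?_
      by_contra! hlt
      have h3 := hΨ.pow_apply_mem_interior_of_le (Nat.le_of_lt_succ hlt)
        (hk.2 diagonalUnit diagonalUnit_mem_psdCone diagonalUnit_ne_zero)
      simp only [pow_succ', pow_zero, Module.End.mul_apply, mul_one] at h3
      rw [mem_interior_psdCone_two_iff] at h3
      simp [detForm_apply, coords_exponentFourMap, coords_diagonalUnit] at h3
      norm_num at h3
    exact_mod_cast this

/-! ### Rank-one matrices and binary quadratic forms -/

/-- The rank-one Hermitian matrix `v * vᴴ`. -/
noncomputable def rankOneHermitian (v : Fin 2 → ℂ) : HermitianMatrix 2 :=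
  ⟨Matrix.vecMulVec v (star v), by
    rw [selfAdjoint.mem_iff, Matrix.star_eq_conjTranspose]
    ext i j; simp [Matrix.vecMulVec_apply, mul_comm]⟩

lemma rankOneHermitian_apply (v : Fin 2 → ℂ) (i j : Fin 2) :
    (rankOneHermitian v).1 i j = v i * star (v j) := rfl

lemma rankOneHermitian_smul (c : ℂ) (v : Fin 2 → ℂ) :
    rankOneHermitian (c • v) = Complex.normSq c • rankOneHermitian v := by
  ext i j
  simp [rankOneHermitian_apply, Complex.normSq_eq_conj_mul_self]
  ring

lemma detForm_eq_two_mul_det (X : HermitianMatrix 2) : detForm X X = 2 * (X.1.det).re := by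
  rw [hermitian_eq_of_coords X, Matrix.det_fin_two, detForm_apply]
  simp
  ring

/-- A singular positive semidefinite `2 × 2` matrix has rank at most one. -/
lemma exists_eq_rankOneHermitian {X : HermitianMatrix 2} (hX : X ∈ psdCone 2)
    (hXX : detForm X X = 0) : ∃ v, X = rankOneHermitian v := by
  obtain ⟨ha, hb⟩ := diag_nonneg_of_mem_psdCone_two hX
  rw [detForm_apply] at hXX
  have hco := hermitian_eq_of_coords X
  set a := hermitianCoords X 0
  set b := hermitianCoords X 1
  set c := hermitianCoords X 2
  set d := hermitianCoords X 3
  rcases ha.eq_or_lt with ha | ha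
  · have hc : c = 0 := pow_eq_zero_iff two_ne_zero |>.1 (by nlinarith)
    have hd : d = 0 := pow_eq_zero_iff two_ne_zero |>.1 (by nlinarith)
    refine ⟨![0, (√b : ℝ)], Subtype.ext ?_⟩
    rw [hco]
    ext i j
    fin_cases i <;> fin_cases j <;> apply Complex.ext <;>
      simp [rankOneHermitian_apply, ← ha, hc, hd, Real.mul_self_sqrt hb]
  · refine ⟨![(√a : ℝ), ⟨c / √a, -d / √a⟩], Subtype.ext ?_⟩
    have hs := Real.sqrt_pos.2 ha
    have hsq := Real.mul_self_sqrt ha.le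
    have hbe : b = c / √a * (c / √a) + d / √a * (d / √a) := by
      rw [div_mul_div_comm, div_mul_div_comm, hsq]
      field_simp
      linarith
    rw [hco]
    ext i j
    fin_cases i <;> fin_cases j <;> apply Complex.ext <;>
      simp [rankOneHermitian_apply, hsq] <;> first | (field_simp; done) | (rw [hbe]; ring1) | ring1

/-- The Lagrange identity over `ℂ`, for the Gram determinant of two vectors. -/
lemma sum_normSq_minors {ι : Type*} (s : Finset ι) (p q : ι → ℂ) :
    ∑ i ∈ s, ∑ j ∈ s, (p i * q j - q i * p j) * star (p i * q j - q i * p j) =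
      2 * ((∑ i ∈ s, p i * star (p i)) * (∑ i ∈ s, q i * star (q i)) -
        (∑ i ∈ s, p i * star (q i)) * (∑ i ∈ s, q i * star (p i))) := by
  have h : ∀ i j, (p i * q j - q i * p j) * star (p i * q j - q i * p j) =
      (p i * star (p i)) * (q j * star (q j)) + (q i * star (q i)) * (p j * star (p j))
      - (p i * star (q i)) * (q j * star (p j)) - (q i * star (p i)) * (p j * star (q j)) := by
    intro i j
    simp only [star_sub, star_mul']
    ring
  simp only [h, Finset.sum_sub_distrib, Finset.sum_add_distrib, ← Finset.sum_mul_sum]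
  ring

/-- A binary quadratic form with three distinct projective zeros is zero. -/
lemma binaryForm_eq_zero {α β γ : ℂ} {u v w : Fin 2 → ℂ} (huv : u 0 * v 1 - u 1 * v 0 ≠ 0)
    (hvw : v 0 * w 1 - v 1 * w 0 ≠ 0) (huw : u 0 * w 1 - u 1 * w 0 ≠ 0)
    (hu : α * u 0 ^ 2 + β * (u 0 * u 1) + γ * u 1 ^ 2 = 0)
    (hv : α * v 0 ^ 2 + β * (v 0 * v 1) + γ * v 1 ^ 2 = 0)
    (hw : α * w 0 ^ 2 + β * (w 0 * w 1) + γ * w 1 ^ 2 = 0) : α = 0 ∧ β = 0 ∧ γ = 0 := by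
  have hne := mul_ne_zero (mul_ne_zero huv hvw) huw
  -- the coefficients are found by Cramer's rule, with a Vandermonde determinant
  refine ⟨mul_left_cancel₀ hne ?_, mul_left_cancel₀ hne ?_, mul_left_cancel₀ hne ?_⟩
  · linear_combination (v 0 * v 1 * w 1 ^ 2 - w 0 * w 1 * v 1 ^ 2) * hu
      - (u 0 * u 1 * w 1 ^ 2 - w 0 * w 1 * u 1 ^ 2) * hv
      + (u 0 * u 1 * v 1 ^ 2 - v 0 * v 1 * u 1 ^ 2) * hw
  · linear_combination -(v 0 ^ 2 * w 1 ^ 2 - w 0 ^ 2 * v 1 ^ 2) * hu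
      + (u 0 ^ 2 * w 1 ^ 2 - w 0 ^ 2 * u 1 ^ 2) * hv
      - (u 0 ^ 2 * v 1 ^ 2 - v 0 ^ 2 * u 1 ^ 2) * hw
  · linear_combination (v 0 ^ 2 * (w 0 * w 1) - w 0 ^ 2 * (v 0 * v 1)) * hu
      - (u 0 ^ 2 * (w 0 * w 1) - w 0 ^ 2 * (u 0 * u 1)) * hv
      + (u 0 ^ 2 * (v 0 * v 1) - v 0 ^ 2 * (u 0 * u 1)) * hw

lemma minor_ne_zero_of_ne_smul {v w : Fin 2 → ℂ} (hv : v ≠ 0)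
    (h : ∀ c : ℝ, rankOneHermitian w ≠ c • rankOneHermitian v) :
    v 0 * w 1 - v 1 * w 0 ≠ 0 := by
  intro h0
  have key : ∃ c : ℂ, w = c • v := by
    by_cases hv0 : v 0 = 0
    · have hv1 : v 1 ≠ 0 := fun hv1 => hv (by ext i; fin_cases i <;> simp [hv0, hv1])
      have hw0 : w 0 = 0 := by simpa [hv0, hv1] using h0
      refine ⟨w 1 / v 1, ?_⟩
      ext i; fin_cases i <;> simp [hv0, hw0, hv1]
    · refine ⟨w 0 / v 0, ?_⟩
      ext i
      fin_cases i
      · simp [hv0]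
      · simp
        field_simp
        linear_combination h0
  obtain ⟨c, rfl⟩ := key
  exact h _ (rankOneHermitian_smul c v)

/-! ### Kraus operators and the upper bound for completely positive maps -/

section CompletelyPositive

open scoped Matrix.Norms.L2Operator MatrixOrder CStarAlgebra

/-- Over an abstract C⋆-algebra, since instance search does not find the functional calculus on
`CStarMatrix` directly. -/
lemma exists_eq_star_mul_self_of_nonneg {A : Type*} [NonUnitalCStarAlgebra A] [PartialOrder A]
    [StarOrderedRing A] {a : A} (h : 0 ≤ a) : ∃ b, a = star b * b :=
  CStarAlgebra.nonneg_iff_eq_star_mul_self.1 h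

/-- A completely positive map acts on rank-one matrices through finitely many Kraus operators `A k`;
they are read off from a square root of the Choi matrix. -/
lemma exists_kraus (Φ : Matrix (Fin 2) (Fin 2) ℂ →CP Matrix (Fin 2) (Fin 2) ℂ) :
    ∃ A : Fin 2 × Fin 2 → Matrix (Fin 2) (Fin 2) ℂ, ∀ (v : Fin 2 → ℂ) (a b : Fin 2),
      (hermitianPart Φ (rankOneHermitian v)).1 a b =
        ∑ k, (A k).mulVec v a * star ((A k).mulVec v b) := by
  -- the block matrix with blocks `E i j` is positive
  let N : CStarMatrix (Fin 2) (Fin 2) (Matrix (Fin 2) (Fin 2) ℂ) :=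
    CStarMatrix.ofMatrix (Matrix.of fun k j => if k = 0 then Matrix.single 0 j 1 else 0)
  have h1 : 0 ≤ (star N * N).map Φ :=
    Φ.map_cstarMatrix_nonneg _ (star_mul_self_nonneg N)
  have hN : ∀ i j, (star N * N) i j = Matrix.single i j (1 : ℂ) := by
    intro i j
    rw [CStarMatrix.mul_apply]
    simp [N, CStarMatrix.star_apply, Matrix.star_eq_conjTranspose]
  obtain ⟨R, hR⟩ := exists_eq_star_mul_self_of_nonneg h1
  have hblock : ∀ i j a b, Φ (Matrix.single i j 1) a b =
      ∑ k, ∑ l, star (R k i l a) * R k j l b := by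
    intro i j a b
    have := congrFun (congrFun hR i) j
    rw [CStarMatrix.map_apply, hN, CStarMatrix.mul_apply] at this
    rw [this, Matrix.sum_apply]
    simp [CStarMatrix.star_apply, Matrix.mul_apply, Matrix.star_apply]
  refine ⟨fun k => Matrix.of fun a i => star (R k.1 i k.2 a), fun v a b => ?_⟩
  change Φ (Matrix.vecMulVec v (star v)) a b = _
  have hv : Matrix.vecMulVec v (star v) =
      ∑ i, ∑ j, (v i * star (v j)) • Matrix.single i j (1 : ℂ) := by
    simp only [Matrix.smul_single, smul_eq_mul, mul_one]
    exact Matrix.matrix_eq_sum_single _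
  rw [hv]
  simp only [map_sum, map_smul]
  simp only [Matrix.sum_apply, Matrix.add_apply, Matrix.smul_apply, hblock, smul_eq_mul,
    Fin.sum_univ_two, Fintype.sum_prod_type, Matrix.mulVec, dotProduct, Matrix.of_apply,
    star_add, star_mul', star_star]
  ring

/-- If a completely positive map sends three pairwise non-proportional rank-one matrices to singular
matrices, it sends all rank-one matrices to singular ones. -/
lemma detForm_hermitianPart_eq_zero
    (Φ : Matrix (Fin 2) (Fin 2) ℂ →CP Matrix (Fin 2) (Fin 2) ℂ) {u v w : Fin 2 → ℂ}
    (huv : u 0 * v 1 - u 1 * v 0 ≠ 0) (hvw : v 0 * w 1 - v 1 * w 0 ≠ 0)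
    (huw : u 0 * w 1 - u 1 * w 0 ≠ 0)
    (hu : detForm (hermitianPart Φ (rankOneHermitian u)) (hermitianPart Φ (rankOneHermitian u)) = 0)
    (hv : detForm (hermitianPart Φ (rankOneHermitian v)) (hermitianPart Φ (rankOneHermitian v)) = 0)
    (hw : detForm (hermitianPart Φ (rankOneHermitian w)) (hermitianPart Φ (rankOneHermitian w)) = 0)
    (x : Fin 2 → ℂ) :
    detForm (hermitianPart Φ (rankOneHermitian x)) (hermitianPart Φ (rankOneHermitian x)) = 0 := by
  obtain ⟨A, hA⟩ := exists_kraus Φ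
  -- by the Lagrange identity, the determinant is a sum of squared moduli of binary quadratic forms
  let D : Fin 2 × Fin 2 → Fin 2 × Fin 2 → (Fin 2 → ℂ) → ℂ := fun k l y =>
    (A k).mulVec y 0 * (A l).mulVec y 1 - (A k).mulVec y 1 * (A l).mulVec y 0
  have hdet : ∀ y, detForm (hermitianPart Φ (rankOneHermitian y))
      (hermitianPart Φ (rankOneHermitian y)) = ∑ k, ∑ l, Complex.normSq (D k l y) := by
    intro y
    have hsum := sum_normSq_minors Finset.univ (fun k => (A k).mulVec y 0)
      (fun k => (A k).mulVec y 1)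
    rw [← hA y, ← hA y, ← hA y, ← hA y, mul_comm ((hermitianPart Φ (rankOneHermitian y)).1 0 1),
      mul_comm ((hermitianPart Φ (rankOneHermitian y)).1 1 0),
      ← Matrix.det_fin_two] at hsum
    rw [detForm_eq_two_mul_det]
    have := congrArg Complex.re hsum
    simp only [Complex.re_sum, Complex.star_def, Complex.mul_conj, Complex.ofReal_re] at this
    simpa [D] using this.symm
  have hD : ∀ y, detForm (hermitianPart Φ (rankOneHermitian y))
      (hermitianPart Φ (rankOneHermitian y)) = 0 ↔ ∀ k l, D k l y = 0 := by
    intro y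
    rw [hdet, Finset.sum_eq_zero_iff_of_nonneg
      fun k _ => Finset.sum_nonneg fun l _ => Complex.normSq_nonneg _]
    refine ⟨fun h k l => ?_, fun h k _ => Finset.sum_eq_zero fun l _ => by simp [h k l]⟩
    exact Complex.normSq_eq_zero.1 ((Finset.sum_eq_zero_iff_of_nonneg
      fun l _ => Complex.normSq_nonneg _).1 (h k (Finset.mem_univ k)) l (Finset.mem_univ l))
  have hexp : ∀ k l, ∃ α β γ : ℂ, ∀ y, D k l y =
      α * y 0 ^ 2 + β * (y 0 * y 1) + γ * y 1 ^ 2 := by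
    intro k l
    refine ⟨A k 0 0 * A l 1 0 - A k 1 0 * A l 0 0,
      A k 0 0 * A l 1 1 + A k 0 1 * A l 1 0 - A k 1 0 * A l 0 1 - A k 1 1 * A l 0 0,
      A k 0 1 * A l 1 1 - A k 1 1 * A l 0 1, fun y => ?_⟩
    simp only [D, Matrix.mulVec, dotProduct, Fin.sum_univ_two]
    ring
  rw [hD] at hu hv hw ⊢
  intro k l
  obtain ⟨α, β, γ, h⟩ := hexp k l
  obtain ⟨h1, h2, h3⟩ := binaryForm_eq_zero huv hvw huw ((h u).symm.trans (hu k l))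
    ((h v).symm.trans (hv k l)) ((h w).symm.trans (hw k l))
  rw [h, h1, h2, h3]
  ring

theorem isConeStrictlyPositive_hermitianPart_pow_three
    {Φ : Matrix (Fin 2) (Fin 2) ℂ →CP Matrix (Fin 2) (Fin 2) ℂ}
    (hΦ : IsConePrimitive (psdCone 2) (hermitianPart Φ)) :
    IsConeStrictlyPositive (psdCone 2) (hermitianPart Φ ^ 3) := by
  by_contra hnot
  obtain ⟨X, hX, h0, hnull⟩ := hΦ.exists_null_orbit hnot
  set Ψ := hermitianPart Φ with hΨ
  have hmem := hΦ.1.pow_apply_mem hX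
  have hne := hΦ.pow_apply_ne_zero hX h0
  have hex : ∀ i ≤ 3, ∃ v, (Ψ ^ i) X = rankOneHermitian v := fun i hi =>
    exists_eq_rankOneHermitian (hmem i) (hnull i hi)
  choose! v hv using hex
  have hminor : ∀ i j, i < j → j ≤ 3 → v i 0 * v j 1 - v i 1 * v j 0 ≠ 0 := by
    intro i j hij hj
    refine minor_ne_zero_of_ne_smul ?_ fun c hc => ?_
    · intro h
      refine hne i ((hv i (by omega)).trans ?_)
      ext; simp [h, rankOneHermitian_apply]
    · rw [← hv i (by omega), ← hv j hj] at hc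
      refine hΦ.pow_apply_ne_smul (hmem i) (hne i) (hnull i (by omega)) (p := j - i) (by omega) c ?_
      rw [← hc, ← Module.End.mul_apply, ← pow_add, Nat.sub_add_cancel hij.le]
  have hsing : ∀ i < 3, detForm (Ψ (rankOneHermitian (v i))) (Ψ (rankOneHermitian (v i))) = 0 := by
    intro i hi
    rw [← hv i hi.le, ← Module.End.mul_apply, ← pow_succ']
    exact hnull (i + 1) hi
  have hrank := detForm_hermitianPart_eq_zero Φ (hminor 0 1 (by omega) (by omega))
    (hminor 1 2 (by omega) (by omega)) (hminor 0 2 (by omega) (by omega)) (hsing 0 (by omega))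
    (hsing 1 (by omega)) (hsing 2 (by omega))
  have hall : ∀ n, detForm ((Ψ ^ n) X) ((Ψ ^ n) X) = 0 := by
    intro n
    induction n with
    | zero => exact hnull 0 (by omega)
    | succ n ih =>
      obtain ⟨y, hy⟩ := exists_eq_rankOneHermitian (hmem n) ih
      rw [pow_succ', Module.End.mul_apply, hy]
      exact hrank y
  obtain ⟨k, hk⟩ := hΦ.exists_forall_ge
  exact (notMem_interior_iff_detForm_eq_zero (hmem k)).2 (hall k) (hk k le_rfl X hX h0)

/-! ### A completely positive map with exponent three -/

/-- The completely positive map `X ↦ ∑ k, A k * X * (A k)ᴴ`. -/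
noncomputable def krausMap {n : ℕ} {ι : Type*} [Fintype ι] (A : ι → Matrix (Fin n) (Fin n) ℂ) :
    Matrix (Fin n) (Fin n) ℂ →CP Matrix (Fin n) (Fin n) ℂ where
  toFun X := ∑ k, A k * X * star (A k)
  map_add' X Y := by simp only [mul_add, add_mul, Finset.sum_add_distrib]
  map_smul' c X := by simp [Finset.smul_sum]
  map_cstarMatrix_nonneg' m M hM := by
    let D : ι → CStarMatrix (Fin m) (Fin m) (Matrix (Fin n) (Fin n) ℂ) := fun k =>
      CStarMatrix.ofMatrix (Matrix.diagonal fun _ => A k)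
    have h : ∑ k, D k * M * star (D k) = M.map fun X => ∑ k, A k * X * star (A k) := by
      ext i j : 1
      have hs : ∀ k, star (D k) = CStarMatrix.ofMatrix (Matrix.diagonal fun _ => star (A k)) := by
        intro k
        ext a b : 1
        by_cases hab : a = b
        · subst hab; simp [D, CStarMatrix.star_apply]
        · simp [D, CStarMatrix.star_apply, hab, Ne.symm hab]
      have hk : ∀ k, (D k * M * star (D k)) i j = A k * M i j * star (A k) := by
        intro k
        rw [hs, CStarMatrix.mul_apply]
        simp [D, CStarMatrix.mul_apply, Matrix.diagonal_apply]
      rw [CStarMatrix.map_apply, ← Finset.sum_congr rfl fun k _ => hk k]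
      exact (congrFun (Finset.sum_apply i _ fun k => D k * M * star (D k)) j).trans
        (Finset.sum_apply j _ fun k => (D k * M * star (D k)) i)
    change 0 ≤ M.map fun X => ∑ k, A k * X * star (A k)
    rw [← h]
    exact Finset.sum_nonneg fun k _ => star_right_conjugate_nonneg hM (D k)

/-- The map with Kraus operators `E₁₀` and `(e₀ + e₁) * e₁ᵀ`, that is `X ↦ X₀₀ • E₁₁ + X₁₁ • J` with
`J` the all-ones matrix. It takes `E₀₀` through the singular matrices `E₁₁` and `J` to the
interior point `E₁₁ + J`. -/
noncomputable def exponentThreeMap : Matrix (Fin 2) (Fin 2) ℂ →CP Matrix (Fin 2) (Fin 2) ℂ :=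
  krausMap ![!![0, 0; 1, 0], !![0, 1; 0, 1]]

lemma coords_exponentThreeMap (X : HermitianMatrix 2) :
    hermitianCoords (hermitianPart exponentThreeMap X) =
      ![hermitianCoords X 1, hermitianCoords X 0 + hermitianCoords X 1, hermitianCoords X 1, 0] := by
  have h : (hermitianPart exponentThreeMap X).1 =
      !![X.1 1 1, X.1 1 1; X.1 1 1, X.1 0 0 + X.1 1 1] := by
    change ∑ k : Fin 2, ![!![0, 0; 1, 0], !![0, 1; 0, 1]] k * X.1 *
      star ((![!![0, 0; 1, 0], !![0, 1; 0, 1]] : Fin 2 → Matrix (Fin 2) (Fin 2) ℂ) k) = _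
    ext i j
    fin_cases i <;> fin_cases j <;>
      simp [Matrix.mul_apply, Fin.sum_univ_two, Matrix.star_apply, Matrix.vecMul, Matrix.vecHead,
        Matrix.vecTail]
  have him : (X.1 1 1).im = 0 := by rw [hermitian_eq_of_coords X]; simp
  ext i
  fin_cases i <;> simp [hermitianCoords, h, him]

lemma isConePrimitive_exponentThreeMap :
    IsConePrimitive (psdCone 2) (hermitianPart exponentThreeMap) := by
  refine ⟨fun X hX => ?_, 3, by norm_num, fun X hX h0 => ?_⟩
  · obtain ⟨ha, hb⟩ := diag_nonneg_of_mem_psdCone_two hX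
    rw [mem_psdCone_two_iff, detForm_apply, hermitianTrace_apply, coords_exponentThreeMap]
    simp
    constructor <;> nlinarith
  · obtain ⟨ha, hb⟩ := diag_nonneg_of_mem_psdCone_two hX
    have ht := hermitianTrace_pos hX h0
    simp only [pow_succ', pow_zero, Module.End.mul_apply, mul_one]
    rw [mem_interior_psdCone_two_iff]
    simp only [detForm_apply, hermitianTrace_apply, coords_exponentThreeMap] at ht ⊢
    simp
    constructor <;> nlinarith

theorem cpMaximalExponent_two : cpMaximalExponent 2 = 3 := by
  apply le_antisymm
  · refine iSup₂_le fun Φ hΦ => ?_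
    have : primitivityIndex (psdCone 2) (hermitianPart Φ) ≤ 3 :=
      Nat.sInf_le ⟨by norm_num, isConeStrictlyPositive_hermitianPart_pow_three hΦ⟩
    exact_mod_cast this
  · have hΨ := isConePrimitive_exponentThreeMap
    refine le_trans ?_ (le_iSup₂_of_le exponentThreeMap hΨ le_rfl)
    have : 3 ≤ primitivityIndex (psdCone 2) (hermitianPart exponentThreeMap) := by
      refine le_csInf hΨ.2 fun k hk => ?_
      by_contra! hlt
      have h2 := hΨ.pow_apply_mem_interior_of_le (Nat.le_of_lt_succ hlt)
        (hk.2 diagonalUnit diagonalUnit_mem_psdCone diagonalUnit_ne_zero)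
      simp only [pow_succ', pow_zero, Module.End.mul_apply, mul_one] at h2
      rw [mem_interior_psdCone_two_iff] at h2
      simp [detForm_apply, coords_exponentThreeMap, coords_diagonalUnit] at h2
      norm_num at h2
    exact_mod_cast this

end CompletelyPositive

theorem theorem3 :
    maximalExponent (psdCone 2) = 4 ∧ cpMaximalExponent 2 = 3 :=
  ⟨maximalExponent_psdCone_two, cpMaximalExponent_two⟩
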